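/- Let $H$ be a complex Hilbert space and let $Q\in\mathbb{B}(H)$ be an idempotent, i.e. a bounded linear operator with $Q^2=Q$. For $T\in\mathbb{B}(H)$ let $|T|=(T^*T)^{1/2}$, and let $|Q^*|^\dagger$ denote the Moore–Penrose inverse of $|Q^*|$ (which exists), i.e. the unique $X\in\mathbb{B}(H)$ such that $|Q^*|X|Q^*|=|Q^*|$, $X|Q^*|X=X$, and both $|Q^*|X$ and $X|Q^*|$ are self-adjoint. The matched projection of $Q$ is $$m(Q)=\tfrac12\big(|Q^*|+Q^*\big)\,|Q^*|^\dagger\,\big(|Q^*|+I\big)^{-1}\big(|Q^*|+Q\big).$$ Call $P\in\mathbb{B}(H)$ a projection if $P^2=P=P^*$. Then $m(Q)$ is a projection, and for every projection $P\in\mathbb{B}(H)$, $$\|m(Q)-Q\|\le\|P-Q\|$$ in the operator norm. Hence $\|m(Q)-Q\|=\min\{\|P-Q\| : P\in\mathbb{B}(H)\text{ a projection}\}$, the minimum being attained at $P=m(Q)$. -/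

import Mathlib

namespace MatchedProjection

variable {H : Type*} [NormedAddCommGroup H] [InnerProductSpace ℂ H] [CompleteSpace H]

/-- `X` is a Moore-Penrose inverse of `T`: the four Penrose equations. -/
structure IsMoorePenroseInverse (T X : H →L[ℂ] H) : Prop where
  mul_mul_left : T * X * T = T
  mul_mul_right : X * T * X = X
  isSelfAdjoint_left : star (T * X) = T * X
  isSelfAdjoint_right : star (X * T) = X * T

/-- An operator has at most one Moore-Penrose inverse. -/
theorem IsMoorePenroseInverse.unique {T X Y : H →L[ℂ] H}
    (hX : IsMoorePenroseInverse T X) (hY : IsMoorePenroseInverse T Y) : X = Y := by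
  have h1 : T * X = T * Y := by
    have a : T * Y * (T * X) = T * X := by rw [← mul_assoc, hY.mul_mul_left]
    have b : T * X * (T * Y) = T * Y := by rw [← mul_assoc, hX.mul_mul_left]
    have c := congrArg star a
    rw [star_mul, hX.isSelfAdjoint_left, hY.isSelfAdjoint_left, b] at c
    exact c.symm
  have h2 : X * T = Y * T := by
    have a : X * T * (Y * T) = X * T := by
      rw [mul_assoc, ← mul_assoc T Y T, hY.mul_mul_left]
    have b : Y * T * (X * T) = Y * T := by
      rw [mul_assoc, ← mul_assoc T X T, hX.mul_mul_left]
    have c := congrArg star a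
    rw [star_mul, hX.isSelfAdjoint_right, hY.isSelfAdjoint_right, b] at c
    exact c.symm
  calc X = X * T * X := hX.mul_mul_right.symm
    _ = Y * (T * X) := by rw [h2, mul_assoc]
    _ = Y * T * Y := by rw [h1, mul_assoc]
    _ = Y := hY.mul_mul_right

open Classical in
/-- The Moore-Penrose inverse `T†` of a bounded operator `T` (with the default value `0` when `T`
has none, that is, when the range of `T` is not closed). -/
noncomputable def moorePenroseInverse (T : H →L[ℂ] H) : H →L[ℂ] H :=
  if h : ∃ X, IsMoorePenroseInverse T X then h.choose else 0

theorem IsMoorePenroseInverse.moorePenroseInverse_eq {T X : H →L[ℂ] H}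
    (hX : IsMoorePenroseInverse T X) : moorePenroseInverse T = X := by
  have h : ∃ X, IsMoorePenroseInverse T X := ⟨X, hX⟩
  rw [moorePenroseInverse, dif_pos h]
  exact h.choose_spec.unique hX

/-- For an idempotent `Q` the default value in `moorePenroseInverse` does not intervene:
`|Q*|` has a Moore-Penrose inverse. -/
theorem isMoorePenroseInverse_abs_star {Q : H →L[ℂ] H} (hQ : IsIdempotentElem Q) :
    IsMoorePenroseInverse (CFC.abs (star Q)) (moorePenroseInverse (CFC.abs (star Q))) := by
  suffices h : ∃ X, IsMoorePenroseInverse (CFC.abs (star Q)) X by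
    obtain ⟨X, hX⟩ := h
    rwa [hX.moorePenroseInverse_eq]
  have hq : Q * Q = Q := hQ
  have hq' : star Q * star Q = star Q := by rw [← star_mul, hq]
  set T := CFC.abs (star Q) with hT
  have hTs : star T = T := (CFC.abs_nonneg (star Q)).isSelfAdjoint
  have hTT : T * T = Q * star Q := by rw [hT, CFC.abs_mul_abs, star_star]
  set Z : H →L[ℂ] H := 1 + star (Q - star Q) * (Q - star Q) with hZ
  have hZu : IsUnit Z := by
    apply CStarAlgebra.isUnit_of_le 1 (b := Z)
    exact le_add_of_nonneg_right (star_mul_self_nonneg _)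
  have hZe : Z = 1 - Q - star Q + Q * star Q + star Q * Q := by
    rw [hZ, star_sub, star_star, sub_mul, mul_sub, mul_sub, hq, hq']; abel
  have hZs : star Z = Z := by rw [hZ]; simp
  have hZQ : Z * Q = Q * star Q * Q := by
    rw [hZe]; simp only [add_mul, sub_mul, one_mul, mul_assoc, hq]; abel
  have hQZ : Q * Z = Q * star Q * Q := by
    rw [hZe]; simp only [mul_add, mul_sub, mul_one, ← mul_assoc, hq]; abel
  have cZQ : Commute Z Q := hZQ.trans hQZ.symm
  have cZQ' : Commute Z (star Q) := by
    have := cZQ.star_star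
    rwa [hZs] at this
  have cZT : Commute Z T := (Commute.cfcAbs_left cZQ'.symm (by rw [hZs]; exact cZQ'.symm)).symm
  obtain ⟨u, hu⟩ := hZu
  set V : H →L[ℂ] H := ((u⁻¹ : (H →L[ℂ] H)ˣ) : H →L[ℂ] H) with hV
  have hVZ : V * Z = 1 := by rw [← hu]; exact u.inv_mul
  have hZV : Z * V = 1 := by rw [← hu]; exact u.mul_inv
  have cVT : Commute V T := by
    have : Commute (u : H →L[ℂ] H) T := by rw [hu]; exact cZT
    exact this.units_inv_left
  have hVs : star V = V := by
    have h : Z * star V = 1 := by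
      have := congrArg star hVZ
      rwa [star_mul, hZs, star_one] at this
    calc star V = V * Z * star V := by rw [hVZ, one_mul]
      _ = V := by rw [mul_assoc, h, mul_one]
  set E := V * (T * T) with hE
  have hEs : star E = E := by
    rw [hE, star_mul, star_mul, hTs, hVs]
    exact ((cVT.mul_right cVT)).eq.symm
  have hES : T * T * E = T * T := by
    have h : (T * T) * (T * T) = Z * (T * T) := by
      rw [hTT]
      calc Q * star Q * (Q * star Q) = (Q * star Q * Q) * star Q := by simp only [mul_assoc]
        _ = Z * (Q * star Q) := by rw [← hZQ, mul_assoc]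
    have c : Commute V (T * T) := cVT.mul_right cVT
    calc T * T * E = V * ((T * T) * (T * T)) := by
          rw [hE, ← mul_assoc, ← c.eq, mul_assoc]
      _ = T * T := by rw [h, ← mul_assoc, hVZ, one_mul]
  have hTE : T * E = T := by
    have h : star (T - T * E) * (T - T * E) = 0 := by
      rw [star_sub, star_mul, hTs, hEs, sub_mul, mul_sub, mul_sub]
      have e1 : T * (T * E) = T * T := by rw [← mul_assoc, hES]
      have e2 : E * T * (T * E) = E * T * T := by
        rw [mul_assoc, e1, ← mul_assoc]
      rw [e1, e2]; simp
    have := CStarRing.star_mul_self_eq_zero_iff _ |>.1 h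
    exact (sub_eq_zero.1 this).symm
  refine ⟨V * T, ?_, ?_, ?_, ?_⟩
  · have : T * (V * T) * T = T * E := by rw [hE]; simp only [mul_assoc]
    rw [this, hTE]
  · have h : T * (V * T) = E := by rw [hE, ← mul_assoc, ← cVT.eq, mul_assoc]
    have : V * T * T * (V * T) = V * T * E := by rw [mul_assoc (V * T), h]
    rw [this, mul_assoc, hTE]
  · have : T * (V * T) = E := by rw [hE, ← mul_assoc, ← cVT.eq, mul_assoc]
    rw [this, hEs]
  · have : V * T * T = E := by rw [hE, mul_assoc]
    rw [this, hEs]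

/-- The matched projection
`m(Q) = (1/2) (|Q*| + Q*) |Q*|† (|Q*| + I)⁻¹ (|Q*| + Q)` of an idempotent `Q`.
Here `CFC.abs T` is `|T|`, the square root of `T* T`. -/
noncomputable def matchedProjection (Q : H →L[ℂ] H) : H →L[ℂ] H :=
  (1 / 2 : ℂ) • ((CFC.abs (star Q) + star Q) * moorePenroseInverse (CFC.abs (star Q)) *
    Ring.inverse (CFC.abs (star Q) + 1) * (CFC.abs (star Q) + Q))

/-- The inverse in `matchedProjection` is a genuine one: `|T| + I` is always invertible. -/
theorem isUnit_abs_add_one (T : H →L[ℂ] H) : IsUnit (CFC.abs T + 1) :=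
  CStarAlgebra.isUnit_of_le 1 (le_add_of_nonneg_left (CFC.abs_nonneg T))

end MatchedProjection

namespace MatchedProjection

variable {H : Type*} [NormedAddCommGroup H] [InnerProductSpace ℂ H] [CompleteSpace H]

/-! Under `P ↦ 2P - 1` projections become symmetries, `Q` becomes the involution `R = 2Q - 1`, and
distances double. The symmetry `M = 2m(Q) - 1` makes `T = MR` positive
(`isStarProjection_matchedProjection_and_nonneg`), so `‖M - R‖ = ‖T - 1‖`. As `M` conjugates `T` to
`T⁻¹ = RM`, both are bounded by `‖R‖`, which is at most `1 + ‖S - R‖` for every symmetry `S`; with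
`T + T⁻¹ ≥ 2` this places `T - 1` between `±‖S - R‖` (`norm_sub_le_of_nonneg_mul`). -/

/-- The Moore-Penrose inverse of a self-adjoint operator is self-adjoint. -/
theorem IsMoorePenroseInverse.star_eq {T X : H →L[ℂ] H} (hX : IsMoorePenroseInverse T X)
    (hT : star T = T) : star X = X := by
  refine IsMoorePenroseInverse.unique (T := T) ⟨?_, ?_, ?_, ?_⟩ hX
  · have := congrArg star hX.mul_mul_left
    simpa [star_mul, hT, mul_assoc] using this
  · have := congrArg star hX.mul_mul_right
    simpa [star_mul, hT, mul_assoc] using this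
  · have := hX.isSelfAdjoint_right
    rw [star_mul, hT] at this
    rw [this, ← this, star_mul, star_star, hT, this]
  · have := hX.isSelfAdjoint_left
    rw [star_mul, hT] at this
    rw [this, ← this, star_mul, star_star, hT, this]

/-- A self-adjoint operator commutes with its Moore-Penrose inverse. -/
theorem IsMoorePenroseInverse.commute {T X : H →L[ℂ] H} (hX : IsMoorePenroseInverse T X)
    (hT : star T = T) : Commute T X := by
  have := hX.isSelfAdjoint_left
  rw [star_mul, hT, hX.star_eq hT] at this
  exact this.symm

theorem IsMoorePenroseInverse.nonneg {T X : H →L[ℂ] H} (hX : IsMoorePenroseInverse T X)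
    (hT : 0 ≤ T) : 0 ≤ X := by
  have h := star_left_conjugate_nonneg hT X
  rwa [hX.star_eq hT.isSelfAdjoint, hX.mul_mul_right] at h

/-- The matched projection is a projection, and `(2 m(Q) - 1) (2 Q - 1)` is positive, so that
`2 m(Q) - 1` is the unitary factor in the polar decomposition of `2 Q - 1`. -/
theorem isStarProjection_matchedProjection_and_nonneg {Q : H →L[ℂ] H}
    (hQ : IsIdempotentElem Q) :
    IsStarProjection (matchedProjection Q) ∧
      0 ≤ (2 * matchedProjection Q - 1) * (2 * Q - 1) := by
  have hq : Q * Q = Q := hQ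
  have hX := isMoorePenroseInverse_abs_star hQ
  have hJ1 := Ring.mul_inverse_cancel _ (isUnit_abs_add_one (star Q))
  have hJ2 := Ring.inverse_mul_cancel _ (isUnit_abs_add_one (star Q))
  have hB0 : 0 ≤ CFC.abs (star Q) := CFC.abs_nonneg _
  have hBB : CFC.abs (star Q) * CFC.abs (star Q) = Q * star Q := by
    rw [CFC.abs_mul_abs, star_star]
  rw [matchedProjection]
  set B := CFC.abs (star Q)
  set X := moorePenroseInverse B
  set J := Ring.inverse (B + 1)
  have hBs : star B = B := hB0.isSelfAdjoint
  have hXs : star X = X := hX.star_eq hBs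
  have hX0 : 0 ≤ X := hX.nonneg hB0
  have cBX : B * X = X * B := hX.commute hBs
  have hJs : star J = J := by
    have h := congrArg star hJ1
    rw [star_mul, star_add, hBs, star_one] at h
    calc star J = star J * ((B + 1) * J) := by rw [hJ1, mul_one]
      _ = J := by rw [← mul_assoc, h, one_mul]
  have hJ0 : 0 ≤ J := by
    have h := star_left_conjugate_nonneg (add_nonneg hB0 zero_le_one) J
    rwa [hJs, hJ2, one_mul] at h
  have cBJ : J * B = B * J := by
    have : J * B + J = B * J + J := by
      rw [← mul_add_one, ← add_one_mul, hJ1, hJ2]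
    exact add_right_cancel this
  have cXJ : J * X = X * J := by
    have h : Commute (B + 1) X :=
      Commute.add_left cBX (Commute.one_left X)
    calc J * X = J * (X * ((B + 1) * J)) := by rw [hJ1, mul_one]
      _ = J * ((B + 1) * X) * J := by rw [h.eq]; simp only [mul_assoc]
      _ = X * J := by rw [← mul_assoc J, hJ2, one_mul]
  set E := B * X with hE
  have hEs : star E = E := hX.isSelfAdjoint_left
  have hEB : E * B = B := hX.mul_mul_left
  have hBE : B * E = B := by rw [hE, (hX.commute hBs).eq, ← mul_assoc, hX.mul_mul_left]
  have hEE : E * E = E := by rw [hE, ← mul_assoc, ← hE, hEB]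
  have hXB : X * B = E := cBX.symm
  have hEX : E * X = X := by rw [← hXB]; exact hX.mul_mul_right
  -- `E` is the projection onto the range of `Q`: it fixes `QQ* = B²`, and the C*-identity for `Q -
  -- EQ` passes this to `Q`. Conversely `E = QQ*X²` gives `QE = E`.
  have hEQ : E * Q = Q := by
    have h : (Q - E * Q) * star (Q - E * Q) = 0 := by
      have h1 : E * (Q * star Q) = Q * star Q := by rw [← hBB, ← mul_assoc, hEB]
      rw [star_sub, star_mul, hEs, sub_mul, mul_sub, mul_sub, mul_assoc E Q (star Q), h1,
        mul_assoc E Q (star Q * E), ← mul_assoc Q (star Q) E, ← mul_assoc E, h1]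
      abel
    exact (sub_eq_zero.1 ((CStarRing.mul_star_self_eq_zero_iff _).1 h)).symm
  have hQE : Q * E = E := by
    have h : E = Q * star Q * (X * X) := by
      rw [← hBB, ← mul_assoc, mul_assoc B B X, ← hE, hBE]
    rw [h]
    calc Q * (Q * star Q * (X * X)) = Q * Q * star Q * (X * X) := by simp only [mul_assoc]
      _ = _ := by rw [hq]
  have hQB : Q * B = B := by rw [← hEB, ← mul_assoc, hQE]
  have hEQ' : star Q * E = star Q := by simpa [hEs] using congrArg star hEQ
  have hBQ' : B * star Q = B := by simpa [hBs] using congrArg star hQB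
  have cEJ : J * E = E * J := by
    rw [hE, ← mul_assoc, cBJ, mul_assoc, cXJ, mul_assoc]
  have hJB : J * B = 1 - J := by
    rw [← hJ2, mul_add_one]; abel
  set m : H →L[ℂ] H := (1 / 2 : ℂ) • ((B + star Q) * X * J * (B + Q)) with hm
  have h2m : 2 * m = (B + star Q) * X * J * (B + Q) := by
    rw [hm, two_mul, ← add_smul]; norm_num
  -- With `V = B + Q`, `m = ½ V* (XJ) V`. Since `XJ` is the Moore-Penrose inverse of `B(B + 1) = ½
  -- VV*`, `m` is idempotent.
  have hVV : (B + Q) * (B + star Q) = 2 * (B * (B + 1)) := by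
    simp only [add_mul, mul_add, hQB, hBQ', ← hBB, mul_one, two_mul]; abel
  have hmid : X * J * (B * (B + 1)) * (X * J) = X * J := by
    have h1 : X * J * (B * (B + 1)) = E := by
      rw [mul_assoc, ← mul_assoc J, cBJ, mul_assoc B, hJ2, mul_one, hXB]
    rw [h1, ← mul_assoc, hEX]
  have hmm : m * m = m := by
    have h4 : (2 * m) * (2 * m) = 2 * (2 * m) := by
      rw [h2m]
      calc (B + star Q) * X * J * (B + Q) * ((B + star Q) * X * J * (B + Q))
          = (B + star Q) * (X * J * ((B + Q) * (B + star Q)) * (X * J)) * (B + Q) := by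
            simp only [mul_assoc]
        _ = (B + star Q) * (2 * (X * J * (B * (B + 1)) * (X * J))) * (B + Q) := by
            rw [hVV]; simp only [two_mul, mul_add, add_mul]
        _ = _ := by rw [hmid]; noncomm_ring
    have h5 : (4 : ℂ) • (m * m) = (4 : ℂ) • m := by
      have e1 : (4 : ℂ) • (m * m) = (2 * m) * (2 * m) := by
        simp only [two_mul, add_mul, mul_add]; module
      have e2 : (4 : ℂ) • m = 2 * (2 * m) := by simp only [two_mul]; module
      rw [e1, e2, h4]
    exact smul_right_injective _ (by norm_num : (4 : ℂ) ≠ 0) h5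
  have hms : star m = m := by
    rw [hm, star_smul, star_mul, star_mul, star_mul, star_add, star_add, hBs, star_star, hXs,
      hJs]
    congr 1
    · simp
    · simp only [← mul_assoc]
      rw [mul_assoc (B + star Q) J X, cXJ]; simp only [mul_assoc]
  refine ⟨⟨hmm, hms⟩, ?_⟩
  have hJBQ : J * (B + Q) * Q = Q := by
    rw [mul_add, add_mul, hJB, mul_assoc J Q, hq, sub_mul, one_mul, sub_add_cancel]
  have h2mQ : 2 * m * Q = Q + star Q * X * Q := by
    rw [h2m, mul_assoc _ J, mul_assoc _ (J * (B + Q)), hJBQ, add_mul, add_mul, ← hE, hEQ]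
  have h2m' : 2 * m = E - E * J + J * Q + star Q * J + star Q * X * J * Q := by
    have a1 : E * J * B = E - E * J := by rw [mul_assoc, hJB, mul_sub, mul_one]
    have a2 : E * J * Q = J * Q := by rw [← cEJ, mul_assoc, hEQ]
    have a3 : star Q * X * J * B = star Q * J := by
      rw [mul_assoc _ J, cBJ, ← mul_assoc, mul_assoc _ X, hXB, hEQ']
    rw [h2m]
    simp only [add_mul, mul_add]
    rw [← hE, a1, a2, a3]; abel
  have hXJ : X - X * J = E * J := by
    have : X * (B * J) = X - X * J := by rw [← cBJ, hJB, mul_sub, mul_one]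
    rw [← this, ← mul_assoc, hXB]
  -- Positivity becomes visible: each summand is `A*CA` with `C` one of `X`, `1`, `J`, all
  -- nonnegative.
  have hT : (2 * m - 1) * (2 * Q - 1) =
      star Q * X * Q + star (1 - E) * (1 - E) + star (Q - E) * J * (Q - E) := by
    have b1 : star Q * X * Q - star Q * X * J * Q = star Q * J * Q := by
      have : star Q * (X - X * J) * Q = star Q * J * Q := by
        rw [hXJ, ← mul_assoc, hEQ']
      rw [← this, mul_sub, sub_mul]; simp only [mul_assoc]
    have b2 : (2 * m - 1) * (2 * Q - 1) = 2 * (2 * m * Q) - 2 * m - 2 * Q + 1 := by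
      noncomm_ring
    have b3 : star (1 - E) * (1 - E) = 1 - E := by
      rw [star_sub, star_one, hEs, mul_sub, mul_one, sub_mul, one_mul, hEE]; abel
    have b4 : star (Q - E) * J * (Q - E) = star Q * J * Q - star Q * J - J * Q + E * J := by
      have c1 : star Q * J * E = star Q * J := by rw [mul_assoc, cEJ, ← mul_assoc, hEQ']
      have c2 : E * J * Q = J * Q := by rw [← cEJ, mul_assoc, hEQ]
      have c3 : E * J * E = E * J := by rw [mul_assoc, cEJ, ← mul_assoc, hEE]
      rw [star_sub, hEs, sub_mul, mul_sub, sub_mul, sub_mul, c1, c2, c3]; abel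
    rw [b2, b3, b4, h2mQ, h2m', ← b1]
    noncomm_ring
  rw [hT]
  exact add_nonneg (add_nonneg (star_left_conjugate_nonneg hX0 Q) (star_mul_self_nonneg _))
    (star_left_conjugate_nonneg hJ0 _)

/-- If `M` is a symmetry with `M R ≥ 0`, where `R` is an involution, then `M` is a closest symmetry
to `R`. -/
theorem norm_sub_le_of_nonneg_mul {M R S : H →L[ℂ] H} (hMs : star M = M) (hMM : M * M = 1)
    (hRR : R * R = 1) (hT : 0 ≤ M * R) (hSs : star S = S) (hSS : S * S = 1) :
    ‖M - R‖ ≤ ‖S - R‖ := by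
  have norm_mul_symm : ∀ {U : H →L[ℂ] H}, star U = U → U * U = 1 → ∀ A, ‖U * A‖ = ‖A‖ :=
    fun {U} h1 h2 A ↦ CStarRing.norm_mem_unitary_mul A
      (Unitary.mem_iff.2 ⟨by rw [h1, h2], by rw [h1, h2]⟩)
  have hS1 : ‖S‖ ≤ 1 := by
    have := norm_mul_symm hSs hSS 1
    rw [mul_one] at this
    rw [this]; exact ContinuousLinearMap.norm_id_le
  set T := M * R with hTd
  set d := ‖S - R‖
  -- The competitor `S` enters only through this bound on `‖R‖ = ‖T‖`.
  have hTn : ‖T‖ ≤ 1 + d := by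
    rw [hTd, norm_mul_symm hMs hMM]
    calc ‖R‖ = ‖S - (S - R)‖ := by rw [sub_sub_cancel]
      _ ≤ _ := (norm_sub_le _ _).trans (by gcongr)
  have hTs : star T = T := hT.isSelfAdjoint
  have hTle : T ≤ algebraMap ℝ _ (1 + d) :=
    (IsSelfAdjoint.le_algebraMap_norm_self (a := T) hTs).trans (algebraMap_mono _ hTn)
  set W := R * M with hWd
  have hMTM : M * T * M = W := by rw [hTd, ← mul_assoc, hMM, one_mul]
  have hTW : T * W = 1 := by
    rw [hTd, hWd, mul_assoc, ← mul_assoc R, hRR, one_mul, hMM]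
  have hWT : W * T = 1 := by
    rw [hTd, hWd, mul_assoc, ← mul_assoc M, hMM, one_mul, hRR]
  have hW0 : 0 ≤ W := by
    have := star_left_conjugate_nonneg hT M
    rwa [hMs, hMTM] at this
  have hWle : W ≤ algebraMap ℝ _ (1 + d) := by
    have := star_left_conjugate_le_conjugate hTle M
    rwa [hMs, hMTM, ← Algebra.commutes, mul_assoc, hMM, mul_one] at this
  -- As `W = T⁻¹`, this is `(T - 1) W (T - 1)`.
  have hsum : 0 ≤ T + W - 2 := by
    have := star_left_conjugate_nonneg hW0 (T - 1)
    rw [star_sub, star_one, hTs] at this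
    convert this using 1
    rw [sub_mul, hTW, mul_sub, sub_mul, one_mul, one_mul, sub_mul, hWT, mul_one, mul_one]
    rw [← one_add_one_eq_two]; abel
  have hMR : ‖M - R‖ = ‖T - 1‖ := by
    rw [← norm_mul_symm hMs hMM, mul_sub, hMM, norm_sub_rev]
  rw [hMR]
  have hsa : IsSelfAdjoint (T - 1) := by
    rw [IsSelfAdjoint, star_sub, star_one, hTs]
  rw [map_add, map_one] at hTle hWle
  have hupper : T - 1 ≤ algebraMap ℝ _ d := sub_le_iff_le_add'.2 hTle
  -- `1 - T ≤ W - 1 ≤ d`, the first inequality being `T + W ≥ 2`.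
  have hlower : algebraMap ℝ _ (-d) ≤ T - 1 := by
    rw [map_neg, neg_le, neg_sub]
    refine le_trans ?_ (sub_le_iff_le_add'.2 hWle)
    rw [← sub_nonneg]
    convert hsum using 1
    rw [← one_add_one_eq_two]; abel
  rw [algebraMap_le_iff_le_spectrum hsa] at hlower
  rw [le_algebraMap_iff_spectrum_le hsa] at hupper
  rw [← cfc_id ℝ (T - 1) hsa]
  exact norm_cfc_le (norm_nonneg _) fun x hx ↦ abs_le.2 ⟨hlower x hx, hupper x hx⟩

end MatchedProjection

/-- The matched projection of a bounded idempotent is an orthogonal projection, and its distance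
to the idempotent is the minimum of the operator-norm distances from orthogonal projections. -/
theorem theorem2p3 {H : Type*} [NormedAddCommGroup H] [InnerProductSpace ℂ H] [CompleteSpace H]
    (Q : H →L[ℂ] H) (hQ : IsIdempotentElem Q) :
    IsStarProjection (MatchedProjection.matchedProjection Q) ∧
      (∀ P : H →L[ℂ] H, IsStarProjection P →
        ‖MatchedProjection.matchedProjection Q - Q‖ ≤ ‖P - Q‖) ∧
      IsLeast {d : ℝ | ∃ P : H →L[ℂ] H, IsStarProjection P ∧ d = ‖P - Q‖}
        ‖MatchedProjection.matchedProjection Q - Q‖ := by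
  obtain ⟨hm, hpos⟩ := MatchedProjection.isStarProjection_matchedProjection_and_nonneg hQ
  have invol : ∀ {P : H →L[ℂ] H}, IsIdempotentElem P → (2 * P - 1) * (2 * P - 1) = 1 := by
    intro P hP
    have h : (2 * P - 1) * (2 * P - 1) = 4 * (P * P) - 4 * P + 1 := by noncomm_ring
    rw [h, hP.eq, sub_self, zero_add]
  have symm : ∀ {P : H →L[ℂ] H}, IsSelfAdjoint P → star (2 * P - 1) = 2 * P - 1 := by
    intro P hP
    rw [two_mul, star_sub, star_add, star_one, hP.star_eq]
  have dist : ∀ P : H →L[ℂ] H, ‖(2 * P - 1) - (2 * Q - 1)‖ = 2 * ‖P - Q‖ := by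
    intro P
    have h : (2 * P - 1) - (2 * Q - 1) = (2 : ℝ) • (P - Q) := by
      rw [two_smul, two_mul, two_mul]; abel
    rw [h, norm_smul, Real.norm_two]
  have hmin : ∀ P : H →L[ℂ] H, IsStarProjection P →
      ‖MatchedProjection.matchedProjection Q - Q‖ ≤ ‖P - Q‖ := by
    intro P hP
    have h := MatchedProjection.norm_sub_le_of_nonneg_mul (symm hm.isSelfAdjoint)
      (invol hm.isIdempotentElem) (invol hQ) hpos (symm hP.isSelfAdjoint)
      (invol hP.isIdempotentElem)
    rw [dist, dist] at h
    linarith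
  refine ⟨hm, hmin, ⟨_, hm, rfl⟩, ?_⟩
  rintro _ ⟨P, hP, rfl⟩
  exact hmin P hP
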